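/- Let $\mathcal T$ be a tree with vertex set $\{1,\dots,k\}$ and let $G_1,\dots,G_k$ be finite connected simple graphs. Let $G$ be a chain of $G_1,\dots,G_k$ with respect to $\mathcal T$: $G$ is obtained from the disjoint union of $G_1,\dots,G_k$ by choosing, for each edge $i\sim j$ of $\mathcal T$, a vertex of $G_i$ and a vertex of $G_j$ and joining the two by an edge. Let $\mathcal B_G$ be the set of the $k-1$ edges (bridges of $G$) so added. For a finite connected graph $H$ let $m_H$ be its number of edges. For the simple random walk on $H$, with stationary distribution $\pi_u=\deg_H(u)/(2m_H)$, let $m^{(H)}_{u,v}$ be the mean first passage time from $u$ to $v$, i.e. the expected value of $\min\{t\ge 0: X_t=v\}$ given $X_0=u$ (so $m^{(H)}_{v,v}=0$). Let $$\kappa(H)=\sum_{u}\sum_{v\ne u}\pi_u\,m^{(H)}_{u,v}\,\pi_v,\qquad \alpha_H(v)=\sum_{u\neq v}\pi_u\,m^{(H)}_{u,v}$$ be Kemeny's constant and the accessibility index of $v$; both are $0$ if $H$ has a single vertex. For a bridge $x\sim y\in\mathcal B_G$ let $W_x$ be the number of edges of the component of $G\setminus (x\sim y)$ that contains $x$, and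 let $\overline W_x=m_G-W_x$; $W_y$ and $\overline W_y$ are defined likewise. Write $G_x$ for the graph $G_i$ that contains $x$, and $\widetilde V_i$ for the family of all ends in $G_i$ of bridges in $\mathcal B_G$, where a vertex incident with several bridges of $\mathcal B_G$ occurs once for each of them, each time with the value of $\overline W$ that belongs to that bridge. Then $$\kappa(G)=\sum_{i=1}^k\kappa(G_i)+\sum_{x\sim y\in\mathcal B_G}\left(\frac{\overline W_x}{m_G}\alpha_{G_x}(x)+\frac{\overline W_y}{m_G}\alpha_{G_y}(y)\right)+\sum_{i=1}^k\ \sum_{(z_1,z_2)\in\widetilde V_i\times\widetilde V_i}\frac{\overline W_{z_1}\overline W_{z_2}}{2m_Gm_{G_i}}\left(m^{(G_i)}_{z_1,z_2}+m^{(G_i)}_{z_2,z_1}\right)+\sum_{x\sim y\in\mathcal B_G}\frac{(2\overline W_x-1)(2\overline W_y-1)}{2m_G},$$ where the terms of the third sum are read as $0$ if $G_i$ has a single vertex. -/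

import Mathlib

namespace SimpleGraph

noncomputable section

open scoped Classical in
/-- The number of edges `m_G`. -/
def numEdges {V : Type*} [Fintype V] (G : SimpleGraph V) : ℕ :=
  G.edgeFinset.card

open scoped Classical in
/-- Transition probabilities of the simple random walk on `G`. -/
def walkProb {V : Type*} [Fintype V] (G : SimpleGraph V) (u v : V) : ℝ :=
  if G.Adj u v then 1 / (G.degree u : ℝ) else 0

open scoped Classical in
/-- The stationary distribution `π = d_G / (2 m_G)` of the simple random walk on `G`. -/
def statDist {V : Type*} [Fintype V] (G : SimpleGraph V) (u : V) : ℝ :=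
  (G.degree u : ℝ) / (2 * (G.numEdges : ℝ))

open scoped Classical in
/-- The probability that the simple random walk `X` started at `X 0 = u` satisfies
`X t ≠ v` for all `t ≤ n`, i.e. that the first passage time
`T_v = min {t ≥ 0 | X t = v}` is larger than `n`: the sum of the probabilities of all
trajectories of `n` steps that start at `u` and avoid `v`. -/
def avoidProb {V : Type*} [Fintype V] (G : SimpleGraph V) (u v : V) (n : ℕ) : ℝ :=
  ∑ x : Fin (n + 1) → V with x 0 = u ∧ ∀ t, x t ≠ v,
    ∏ t : Fin n, G.walkProb (x t.castSucc) (x t.succ)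

/-- The mean first passage time `m_{u,v} = E_u[T_v] = ∑_{n ≥ 0} P_u(T_v > n)` from `u` to `v`
(so `m_{v,v} = 0`). The series converges when `G` is connected: see `summable_avoidProb`. -/
def meanFirstPassage {V : Type*} [Fintype V] (G : SimpleGraph V) (u v : V) : ℝ :=
  ∑' n : ℕ, G.avoidProb u v n

open scoped Classical in
/-- Kemeny's constant `κ(G) = ∑_u ∑_{v ≠ u} π_u m_{u,v} π_v` of the simple random walk. -/
def kemeny {V : Type*} [Fintype V] (G : SimpleGraph V) : ℝ :=
  ∑ u : V, ∑ v : V with v ≠ u, G.statDist u * G.meanFirstPassage u v * G.statDist v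

open scoped Classical in
/-- The accessibility index `α_G(v) = ∑_{u ≠ v} π_u m_{u,v}`. -/
def accessibility {V : Type*} [Fintype V] (G : SimpleGraph V) (v : V) : ℝ :=
  ∑ u : V with u ≠ v, G.statDist u * G.meanFirstPassage u v

/-- `W_x`: the number of edges of the connected component containing `x` of the graph obtained
from `G` by removing the edge `x ∼ y`. -/
def sideEdges {V : Type*} (G : SimpleGraph V) (x y : V) : ℕ :=
  {e ∈ (G.deleteEdges {s(x, y)}).edgeSet |
    ∀ w ∈ e, (G.deleteEdges {s(x, y)}).Reachable x w}.ncard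

/-- `W̄_x = m_G - W_x`, with respect to the edge `x ∼ y`. -/
def coSideEdges {V : Type*} [Fintype V] (G : SimpleGraph V) (x y : V) : ℝ :=
  (G.numEdges : ℝ) - (G.sideEdges x y : ℝ)

/-- The chain of the graphs `G i` with respect to the graph `T`: the disjoint union of the `G i`,
together with, for every edge `i ∼ j` of `T`, one edge that joins the chosen vertex `b i j` of
`G i` to the chosen vertex `b j i` of `G j`. (The values `b i j` with `i`, `j` not adjacent in `T`
play no role.) -/
def chain {ι : Type*} (T : SimpleGraph ι) {V : ι → Type*} (G : (i : ι) → SimpleGraph (V i))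
    (b : (i j : ι) → V i) : SimpleGraph (Σ i, V i) where
  Adj x y :=
    (∃ (i : ι) (u w : V i), (G i).Adj u w ∧ x = ⟨i, u⟩ ∧ y = ⟨i, w⟩) ∨
      (∃ i j : ι, T.Adj i j ∧ x = ⟨i, b i j⟩ ∧ y = ⟨j, b j i⟩)
  symm := ⟨by
    rintro x y (⟨i, u, w, h, hx, hy⟩ | ⟨i, j, h, hx, hy⟩)
    · exact Or.inl ⟨i, w, u, h.symm, hy, hx⟩
    · exact Or.inr ⟨j, i, h.symm, hy, hx⟩⟩
  loopless := ⟨by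
    rintro x (⟨i, u, w, h, rfl, hy⟩ | ⟨i, j, h, rfl, hy⟩)
    · cases hy
      exact h.ne rfl
    · exact h.ne (congrArg Sigma.fst hy)⟩

/-- `W̄_x` in the chain, for the end `x = b i j` in `G i` of the bridge that corresponds to the edge
`i ∼ j` of `T`. -/
def chainWbar {ι : Type*} [Fintype ι] (T : SimpleGraph ι) {V : ι → Type*} [∀ i, Fintype (V i)]
    (G : (i : ι) → SimpleGraph (V i)) (b : (i j : ι) → V i) (i j : ι) : ℝ :=
  (chain T G b).coSideEdges ⟨i, b i j⟩ ⟨j, b j i⟩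

/-! ### The mean first passage times are finite -/

section WellDefined

variable {V : Type*} [Fintype V] (G : SimpleGraph V)

theorem walkProb_nonneg (u v : V) : 0 ≤ G.walkProb u v := by
  unfold walkProb
  split_ifs <;> positivity

theorem sum_walkProb_le_one (u : V) : ∑ w, G.walkProb u w ≤ 1 := by
  classical
  unfold walkProb
  rw [← Finset.sum_filter, Finset.sum_const, nsmul_eq_mul]
  have h : (Finset.univ.filter fun w => G.Adj u w).card = G.degree u := by
    rw [← G.card_neighborFinset_eq_degree]
    congr 1
    ext w
    simp
  have h2 : ((Finset.univ.filter fun w => G.Adj u w).card : ℝ) * (1 / (G.degree u : ℝ)) ≤ 1 := by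
    rw [h, mul_one_div]
    exact div_self_le_one _
  convert h2 using 3

theorem avoidProb_nonneg (u v : V) (n : ℕ) : 0 ≤ G.avoidProb u v n :=
  Finset.sum_nonneg fun _ _ => Finset.prod_nonneg fun _ _ => G.walkProb_nonneg _ _

theorem avoidProb_self (v : V) (n : ℕ) : G.avoidProb v v n = 0 := by
  classical
  unfold avoidProb
  apply Finset.sum_eq_zero
  intro x hx
  simp only [Finset.mem_filter] at hx
  exact absurd hx.2.1 (hx.2.2 0)

theorem avoidProb_zero {u v : V} (h : u ≠ v) : G.avoidProb u v 0 = 1 := by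
  classical
  unfold avoidProb
  rw [Finset.sum_eq_single (fun _ => u)]
  · simp
  · intro x hx hne
    simp only [Finset.mem_filter] at hx
    exact absurd (funext fun t => by
      have ht : t = 0 := Fin.ext (by omega)
      rw [ht]
      exact hx.2.1) hne
  · intro hx
    simp [h] at hx

/-- First step analysis. -/
theorem avoidProb_succ {u v : V} (h : u ≠ v) (n : ℕ) :
    G.avoidProb u v (n + 1) = ∑ w, G.walkProb u w * G.avoidProb w v n := by
  classical
  have key : ∀ w, G.walkProb u w * G.avoidProb w v n =
      ∑ x : Fin (n + 1) → V, if x 0 = w ∧ ∀ t, x t ≠ v then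
        G.walkProb u (x 0) * ∏ t : Fin n, G.walkProb (x t.castSucc) (x t.succ) else 0 := by
    intro w
    unfold avoidProb
    rw [Finset.mul_sum, Finset.sum_filter]
    refine Finset.sum_congr rfl fun x _ => ?_
    by_cases hx : x 0 = w ∧ ∀ t, x t ≠ v
    · simp only [if_pos hx]
      rw [hx.1]
    · simp only [if_neg hx]
  simp_rw [key]
  rw [Finset.sum_comm]
  unfold avoidProb
  rw [Finset.sum_filter, ← (Fin.consEquiv fun _ : Fin (n + 2) => V).sum_comp,
    Fintype.sum_prod_type, Finset.sum_comm]
  refine Finset.sum_congr rfl fun x _ => ?_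
  rw [Finset.sum_eq_single u, Finset.sum_eq_single (x 0)]
  · simp [Fin.consEquiv, Fin.forall_fin_succ (n := n + 1), h, Fin.prod_univ_succ (n := n)]
  · intro w _ hw
    rw [if_neg]
    exact fun hx => hw hx.1.symm
  · simp
  · intro w _ hw
    rw [if_neg]
    exact fun hx => hw (by simpa [Fin.consEquiv] using hx.1)
  · simp

/-- On a connected graph the series that defines `meanFirstPassage` converges. -/
theorem summable_avoidProb (hG : G.Connected) (u v : V) : Summable (G.avoidProb u v) := by
  classical
  set N : ℝ := (Fintype.card V : ℝ) with hN
  have hN1 : 1 ≤ N := by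
    have : 0 < Fintype.card V := Fintype.card_pos_iff.2 ⟨u⟩
    rw [hN]
    exact_mod_cast this
  set D : ℕ := ∑ w, G.dist w v with hD
  have hdist : ∀ w, G.dist w v ≤ D := fun w =>
    Finset.single_le_sum (f := fun w => G.dist w v) (fun _ _ => Nat.zero_le _) (Finset.mem_univ w)
  set g : V → ℝ := fun w => (2 * N) ^ (D - G.dist w v) with hg
  have hg1 : ∀ w, 1 ≤ g w := fun w => one_le_pow₀ (by linarith)
  have hgM : ∀ w, g w ≤ (2 * N) ^ D := fun w =>
    pow_le_pow_right₀ (by linarith) (Nat.sub_le _ _)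
  have hstep : ∀ w, w ≠ v → g w + 1 ≤ ∑ z, G.walkProb w z * g z := by
    intro w hw
    obtain ⟨p, hp⟩ := hG.exists_walk_length_eq_dist w v
    cases p with
    | nil => exact absurd rfl hw
    | @cons _ z _ hadj q =>
      have hz : G.dist z v + 1 ≤ G.dist w v := by
        rw [← hp, Walk.length_cons]
        exact Nat.succ_le_succ (dist_le q)
      have hdw := hdist w
      have h1 : G.walkProb w z * g z ≤ ∑ z, G.walkProb w z * g z :=
        Finset.single_le_sum (f := fun z => G.walkProb w z * g z)
          (fun y _ => mul_nonneg (G.walkProb_nonneg _ _) (by linarith [hg1 y])) (Finset.mem_univ z)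
      have h2 : 2 * N * g w ≤ g z := by
        simp only [hg]
        rw [← pow_succ']
        exact pow_le_pow_right₀ (by linarith) (by omega)
      have h3 : 1 / N ≤ G.walkProb w z := by
        unfold walkProb
        rw [if_pos hadj]
        apply one_div_le_one_div_of_le
        · have : 0 < G.degree w := (G.degree_pos_iff_exists_adj w).2 ⟨z, hadj⟩
          exact_mod_cast this
        · have : G.degree w ≤ Fintype.card V := (G.degree_lt_card_verts w).le
          rw [hN]
          exact_mod_cast this
      have h4 : 2 * g w ≤ G.walkProb w z * g z := by
        calc 2 * g w = 1 / N * (2 * N * g w) := by field_simp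
          _ ≤ G.walkProb w z * g z :=
            mul_le_mul h3 h2 (by have := hg1 w; positivity) (G.walkProb_nonneg _ _)
      linarith [hg1 w]
  have hbound : ∀ n w, ∑ i ∈ Finset.range n, G.avoidProb w v i ≤ (2 * N) ^ D - g w := by
    intro n
    induction n with
    | zero => intro w; simpa using hgM w
    | succ n ih =>
      intro w
      by_cases hw : w = v
      · subst hw
        simp only [avoidProb_self, Finset.sum_const_zero]
        linarith [hgM w]
      · rw [Finset.sum_range_succ', G.avoidProb_zero hw]
        simp_rw [G.avoidProb_succ hw]
        rw [Finset.sum_comm]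
        simp_rw [← Finset.mul_sum]
        have h1 : ∑ z, G.walkProb w z * ∑ i ∈ Finset.range n, G.avoidProb z v i ≤
            ∑ z, G.walkProb w z * ((2 * N) ^ D - g z) :=
          Finset.sum_le_sum fun z _ => mul_le_mul_of_nonneg_left (ih z) (G.walkProb_nonneg _ _)
        simp_rw [mul_sub, Finset.sum_sub_distrib] at h1
        rw [← Finset.sum_mul] at h1
        have h2 : (∑ z, G.walkProb w z) * (2 * N) ^ D ≤ 1 * (2 * N) ^ D :=
          mul_le_mul_of_nonneg_right (G.sum_walkProb_le_one w) (by positivity)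
        linarith [hstep w hw]
  exact summable_of_sum_range_le (fun n => G.avoidProb_nonneg u v n) fun n => hbound n u

end WellDefined

end

end SimpleGraph

namespace SimpleGraph

noncomputable section

/-! Everything is expressed through effective resistance. If `H` is connected with `m` edges,
degrees `d` and resistance `R`, then `m_{u,v} + m_{v,u} = 2 m R(u,v)`, `κ(H) = (1 / 4m) ∑ d_u d_v
R(u,v)` and `α_H(v) = ∑ d_w R(w,v) - κ(H)` (`IsResistance.meanFirstPassage_add`,
`IsResistance.kemeny_eq`, `IsResistance.accessibility_eq`). These use only the equation `L R(·,v) =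
c - 2 δ_v`, so any solution serves as `R`; `exists_isResistance` provides one.

Resistances add in series along a chain: `R_G(x,y)` is the sum over `l` of the resistance in `G l`
between the projections of `x` and `y`, plus the number of bridges separating `x` from `y`
(`isResistance_chainResistance`). The projection to `G l` carries the degree measure of the chain to
the degree measure of `G l` plus an atom `2 W̄` at each bridge end (`sum_realDegree_mul_chainProj`).

Expanding the quadratic form of `R_l` in this measure gives the first three sums: degree against
degree yields `κ(G l)`, degree against atom yields `α` and a further multiple of `κ(G l)`, and atom
against atom yields the commute times. The separation count gives the last sum, since the degree sum
beyond a bridge is `2 W̄ - 1`. -/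

open scoped Classical in
/-- The indicator of a proposition, as a real number. -/
def indicatorOf (p : Prop) : ℝ := if p then 1 else 0

theorem indicatorOf_pos {p : Prop} (h : p) : indicatorOf p = 1 := by
  simp [indicatorOf, h]

theorem indicatorOf_neg {p : Prop} (h : ¬ p) : indicatorOf p = 0 := by
  simp [indicatorOf, h]

theorem indicatorOf_congr {p q : Prop} (h : p ↔ q) : indicatorOf p = indicatorOf q := by
  rw [propext h]

theorem sum_indicatorOf_eq_mul {α : Type*} [Fintype α] (a : α) (f : α → ℝ) :
    ∑ x, indicatorOf (x = a) * f x = f a := by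
  classical
  simp [indicatorOf]

theorem sum_mul_indicatorOf_eq {α : Type*} [Fintype α] (a : α) (f : α → ℝ) :
    ∑ x, f x * indicatorOf (a = x) = f a := by
  classical
  simp [indicatorOf]

theorem sum_filter_eq_sum_indicatorOf {α : Type*} [Fintype α] (p : α → Prop) [DecidablePred p]
    (f : α → ℝ) : ∑ x with p x, f x = ∑ x, indicatorOf (p x) * f x := by
  rw [Finset.sum_filter]
  refine Finset.sum_congr rfl fun x _ => ?_
  by_cases h : p x
  · rw [if_pos h, indicatorOf_pos h, one_mul]
  · rw [if_neg h, indicatorOf_neg h, zero_mul]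

/-! ### The Laplacian and effective resistance -/

section Resistance

variable {V : Type*} [Fintype V] (G : SimpleGraph V)

/-- The degree of a vertex, as a real number. -/
def realDegree (u : V) : ℝ := ∑ w, indicatorOf (G.Adj u w)

/-- The graph Laplacian applied to a function on the vertices. -/
def laplacian (f : V → ℝ) (u : V) : ℝ := ∑ w, indicatorOf (G.Adj u w) * (f u - f w)

theorem realDegree_eq_degree (u : V) [Fintype (G.neighborSet u)] :
    G.realDegree u = G.degree u := by
  classical
  unfold realDegree indicatorOf
  rw [Finset.sum_boole, ← G.card_neighborFinset_eq_degree]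
  congr 2
  ext w
  simp

theorem realDegree_nonneg (u : V) : 0 ≤ G.realDegree u := by
  classical
  rw [realDegree_eq_degree]
  positivity

theorem sum_realDegree : ∑ u, G.realDegree u = 2 * (G.numEdges : ℝ) := by
  classical
  simp_rw [realDegree_eq_degree]
  unfold numEdges
  exact_mod_cast G.sum_degrees_eq_twice_card_edges

theorem statDist_eq (u : V) : G.statDist u = G.realDegree u / (2 * (G.numEdges : ℝ)) := by
  classical
  rw [statDist, realDegree_eq_degree]

theorem realDegree_eq_zero_of_numEdges (h : G.numEdges = 0) (u : V) : G.realDegree u = 0 := by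
  have h1 := G.sum_realDegree
  rw [h, Nat.cast_zero, mul_zero,
    Finset.sum_eq_zero_iff_of_nonneg fun u _ => G.realDegree_nonneg u] at h1
  exact h1 u (Finset.mem_univ u)

theorem sum_laplacian (f : V → ℝ) : ∑ u, G.laplacian f u = 0 := by
  have h : ∑ u, G.laplacian f u = -∑ u, G.laplacian f u := by
    unfold laplacian
    conv_lhs => rw [Finset.sum_comm]
    rw [← Finset.sum_neg_distrib]
    refine Finset.sum_congr rfl fun u _ => ?_
    rw [← Finset.sum_neg_distrib]
    refine Finset.sum_congr rfl fun w _ => ?_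
    rw [indicatorOf_congr (G.adj_comm w u)]
    ring
  linarith

theorem laplacian_add (f g : V → ℝ) (u : V) :
    G.laplacian (fun x => f x + g x) u = G.laplacian f u + G.laplacian g u := by
  unfold laplacian
  rw [← Finset.sum_add_distrib]
  exact Finset.sum_congr rfl fun w _ => by ring

theorem laplacian_sub (f g : V → ℝ) (u : V) :
    G.laplacian (fun x => f x - g x) u = G.laplacian f u - G.laplacian g u := by
  unfold laplacian
  rw [← Finset.sum_sub_distrib]
  exact Finset.sum_congr rfl fun w _ => by ring

theorem laplacian_const_mul (c : ℝ) (f : V → ℝ) (u : V) :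
    G.laplacian (fun x => c * f x) u = c * G.laplacian f u := by
  unfold laplacian
  rw [Finset.mul_sum]
  exact Finset.sum_congr rfl fun w _ => by ring

theorem laplacian_const (c : ℝ) (u : V) : G.laplacian (fun _ => c) u = 0 := by
  simp [laplacian]

theorem laplacian_sum {α : Type*} (s : Finset α) (f : α → V → ℝ) (u : V) :
    G.laplacian (fun x => ∑ a ∈ s, f a x) u = ∑ a ∈ s, G.laplacian (f a) u := by
  unfold laplacian
  rw [Finset.sum_comm]
  refine Finset.sum_congr rfl fun w _ => ?_
  rw [← Finset.mul_sum, Finset.sum_sub_distrib]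

theorem laplacian_eq (f : V → ℝ) (u : V) :
    G.laplacian f u = G.realDegree u * f u - ∑ w, indicatorOf (G.Adj u w) * f w := by
  unfold laplacian realDegree
  rw [Finset.sum_mul, ← Finset.sum_sub_distrib]
  exact Finset.sum_congr rfl fun w _ => by ring

/-- The Dirichlet form. -/
theorem two_mul_sum_mul_laplacian (f : V → ℝ) :
    2 * ∑ u, f u * G.laplacian f u = ∑ u, ∑ w, indicatorOf (G.Adj u w) * (f u - f w) ^ 2 := by
  have h1 : ∑ u, f u * G.laplacian f u =
      ∑ u, ∑ w, indicatorOf (G.Adj u w) * (f u * (f u - f w)) := by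
    refine Finset.sum_congr rfl fun u _ => ?_
    rw [laplacian, Finset.mul_sum]
    exact Finset.sum_congr rfl fun w _ => by ring
  have h2 : ∑ u, f u * G.laplacian f u =
      ∑ u, ∑ w, indicatorOf (G.Adj u w) * (f w * (f w - f u)) := by
    rw [h1, Finset.sum_comm]
    refine Finset.sum_congr rfl fun u _ => Finset.sum_congr rfl fun w _ => ?_
    rw [indicatorOf_congr (G.adj_comm w u)]
  rw [two_mul]
  nth_rewrite 1 [h1]
  rw [h2, ← Finset.sum_add_distrib]
  refine Finset.sum_congr rfl fun u _ => ?_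
  rw [← Finset.sum_add_distrib]
  exact Finset.sum_congr rfl fun w _ => by ring

theorem indicatorOf_nonneg (p : Prop) : 0 ≤ indicatorOf p := by
  unfold indicatorOf
  split_ifs <;> norm_num

theorem sum_mul_laplacian_nonneg (f : V → ℝ) : 0 ≤ ∑ u, f u * G.laplacian f u := by
  have h := G.two_mul_sum_mul_laplacian f
  have : 0 ≤ ∑ u, ∑ w, indicatorOf (G.Adj u w) * (f u - f w) ^ 2 :=
    Finset.sum_nonneg fun u _ => Finset.sum_nonneg fun w _ =>
      mul_nonneg (indicatorOf_nonneg _) (sq_nonneg _)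
  linarith

variable {G}

/-- The Dirichlet form is a sum of nonnegative terms, so each one vanishes and `f` does not change
across an edge; a walk carries this to any two vertices. -/
theorem eq_of_sum_mul_laplacian_eq_zero (hG : G.Connected) {f : V → ℝ}
    (hf : ∑ u, f u * G.laplacian f u = 0) (u v : V) : f u = f v := by
  have h := G.two_mul_sum_mul_laplacian f
  rw [hf, mul_zero] at h
  have hnn : ∀ u w, 0 ≤ indicatorOf (G.Adj u w) * (f u - f w) ^ 2 := fun u w =>
    mul_nonneg (indicatorOf_nonneg _) (sq_nonneg _)
  have hadj : ∀ u w, G.Adj u w → f u = f w := by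
    intro u w huw
    have h1 := (Finset.sum_eq_zero_iff_of_nonneg
      (fun u _ => Finset.sum_nonneg fun w _ => hnn u w)).1 h.symm u (Finset.mem_univ u)
    have h2 := (Finset.sum_eq_zero_iff_of_nonneg (fun w _ => hnn u w)).1 h1 w (Finset.mem_univ w)
    rw [indicatorOf_pos huw, one_mul] at h2
    exact sub_eq_zero.1 (pow_eq_zero_iff two_ne_zero |>.1 h2)
  obtain ⟨p⟩ := hG.preconnected u v
  induction p with
  | nil => rfl
  | cons h _ ih => exact (hadj _ _ h).trans ih

/-- A function that vanishes at `v` is determined by its Laplacian off `v`. -/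
theorem eq_of_laplacian_eq (hG : G.Connected) {f g : V → ℝ} {v : V} (hv : f v = g v)
    (h : ∀ u, u ≠ v → G.laplacian f u = G.laplacian g u) : f = g := by
  classical
  have hoff : ∀ u, u ≠ v → G.laplacian (fun x => f x - g x) u = 0 := fun u hu => by
    rw [laplacian_sub, h u hu, sub_self]
  have hsum : ∑ u, (f u - g u) * G.laplacian (fun x => f x - g x) u = 0 := by
    refine Finset.sum_eq_zero fun u _ => ?_
    by_cases hu : u = v
    · rw [hu, hv, sub_self, zero_mul]
    · rw [hoff u hu, mul_zero]
  funext u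
  have h1 := eq_of_sum_mul_laplacian_eq_zero hG (f := fun x => f x - g x) hsum u v
  simp only [hv, sub_self] at h1
  linarith

/-- The characteristic properties of the effective resistance: it is symmetric, vanishes on the
diagonal, and its Laplacian in one variable is `c - 2 δ_v` with `c` independent of `v`. -/
structure IsResistance (G : SimpleGraph V) (R : V → V → ℝ) : Prop where
  symm : ∀ u v, R u v = R v u
  self : ∀ v, R v v = 0
  exists_laplacian : ∃ c : V → ℝ, ∀ u v,
    G.laplacian (fun x => R x v) u = c u - 2 * indicatorOf (u = v)

/-- With `J` the all-ones matrix, `L + J` has quadratic form the Dirichlet energy plus `(∑ f)²`. If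
this vanishes, `f` is constant with sum zero, hence zero; so `L + J` has an inverse `P`, and the
resistance is read off from `P`. -/
theorem exists_isResistance (hG : G.Connected) : ∃ R, IsResistance G R := by
  classical
  set M : Matrix V V ℝ := Matrix.of fun u w =>
    indicatorOf (u = w) * G.realDegree u - indicatorOf (G.Adj u w) + 1 with hM
  have hmul : ∀ (f : V → ℝ) u, M.mulVec f u = G.laplacian f u + ∑ w, f w := by
    intro f u
    rw [laplacian_eq]
    simp only [Matrix.mulVec, dotProduct, hM, Matrix.of_apply]
    have : G.realDegree u * f u = ∑ w, indicatorOf (w = u) * (G.realDegree u * f w) :=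
      (sum_indicatorOf_eq_mul u fun w => G.realDegree u * f w).symm
    rw [this, ← Finset.sum_sub_distrib, ← Finset.sum_add_distrib]
    refine Finset.sum_congr rfl fun w _ => ?_
    rw [indicatorOf_congr (eq_comm (a := w) (b := u))]
    ring
  have hsymm : M.transpose = M := by
    ext u w
    simp only [Matrix.transpose_apply, hM, Matrix.of_apply]
    rw [indicatorOf_congr (G.adj_comm w u)]
    by_cases h : u = w
    · rw [h]
    · rw [indicatorOf_neg h, indicatorOf_neg (Ne.symm h), zero_mul, zero_mul]
  have hker : ∀ f : V → ℝ, M.mulVec f = 0 → f = 0 := by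
    intro f hf
    have h1 : ∑ u, f u * G.laplacian f u + (∑ w, f w) ^ 2 = 0 := by
      have : ∑ u, f u * M.mulVec f u = 0 := by simp [hf]
      simp_rw [hmul, mul_add, Finset.sum_add_distrib, ← Finset.sum_mul] at this
      rw [sq]
      exact this
    have h2 := G.sum_mul_laplacian_nonneg f
    have h3 : ∑ u, f u * G.laplacian f u = 0 := by nlinarith [sq_nonneg (∑ w, f w)]
    have h4 : ∑ w, f w = 0 := by
      rw [h3, zero_add] at h1
      exact pow_eq_zero_iff two_ne_zero |>.1 h1
    funext u
    have h5 : ∑ w, f w = Fintype.card V * f u := by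
      rw [Finset.sum_congr rfl fun w _ => eq_of_sum_mul_laplacian_eq_zero hG h3 w u]
      simp
    rw [h4] at h5
    have : (Fintype.card V : ℝ) ≠ 0 := by
      exact_mod_cast (Fintype.card_pos_iff.2 ⟨u⟩).ne'
    simpa [this] using h5.symm
  have hdet : M.det ≠ 0 := by
    intro h
    obtain ⟨f, hf, hf0⟩ := Matrix.exists_mulVec_eq_zero_iff.2 h
    exact hf (hker f hf0)
  set P := M⁻¹ with hP
  have hMP : M * P = 1 := Matrix.mul_nonsing_inv _ (isUnit_iff_ne_zero.2 hdet)
  have hPsymm : ∀ u v, P u v = P v u := by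
    intro u v
    have : P.transpose = P := by rw [hP, Matrix.transpose_nonsing_inv, hsymm]
    exact congrFun (congrFun this v) u
  have hcol : ∀ u v, G.laplacian (fun x => P x v) u + ∑ w, P w v = indicatorOf (u = v) := by
    intro u v
    rw [← hmul (fun x => P x v) u]
    have := congrFun (congrFun hMP u) v
    rw [Matrix.mul_apply] at this
    simp only [Matrix.mulVec, dotProduct]
    rw [this, Matrix.one_apply, indicatorOf]
  have hn : (Fintype.card V : ℝ) ≠ 0 := by
    have := hG.nonempty
    exact_mod_cast Fintype.card_ne_zero
  -- Summing the column equation over all vertices kills the Laplacian term.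
  have hsum : ∀ v, ∑ w, P w v = 1 / Fintype.card V := by
    intro v
    have h : ∑ u, (G.laplacian (fun x => P x v) u + ∑ w, P w v) = 1 := by
      simp_rw [hcol]
      simpa using sum_indicatorOf_eq_mul v (fun _ => 1)
    rw [Finset.sum_add_distrib, sum_laplacian, zero_add] at h
    simp only [Finset.sum_const, Finset.card_univ, nsmul_eq_mul] at h
    field_simp
    linarith
  refine ⟨fun u v => P u u + P v v - 2 * P u v, fun u v => ?_, fun v => ?_,
    fun u => G.laplacian (fun x => P x x) u + 2 / Fintype.card V, fun u v => ?_⟩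
  · rw [hPsymm u v]
    ring
  · ring
  · rw [laplacian_sub, laplacian_add, laplacian_const, laplacian_const_mul,
      eq_sub_of_add_eq (hcol u v), hsum]
    ring

/-! ### Passage times, Kemeny's constant and accessibility through resistance -/

theorem meanFirstPassage_self (v : V) : G.meanFirstPassage v v = 0 := by
  simp [meanFirstPassage, avoidProb_self]

/-- First step analysis for the mean first passage times. -/
theorem meanFirstPassage_eq_one_add (hG : G.Connected) {u v : V} (h : u ≠ v) :
    G.meanFirstPassage u v = 1 + ∑ w, G.walkProb u w * G.meanFirstPassage w v := by
  unfold meanFirstPassage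
  rw [(G.summable_avoidProb hG u v).tsum_eq_zero_add, G.avoidProb_zero h]
  simp_rw [G.avoidProb_succ h, ← tsum_mul_left]
  rw [Summable.tsum_finsetSum fun w _ => (G.summable_avoidProb hG w v).mul_left _]

/-- This is the first step equation multiplied by the degree of `u`, which is nonzero because `u`
and `v` are distinct vertices of a connected graph. -/
theorem laplacian_meanFirstPassage (hG : G.Connected) {u v : V} (h : u ≠ v) :
    G.laplacian (fun x => G.meanFirstPassage x v) u = G.realDegree u := by
  classical
  have hd : G.realDegree u ≠ 0 := by
    have : Nontrivial V := ⟨u, v, h⟩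
    rw [realDegree_eq_degree]
    exact_mod_cast (hG.preconnected.degree_pos_of_nontrivial u).ne'
  rw [laplacian_eq, meanFirstPassage_eq_one_add hG h, mul_add, Finset.mul_sum, mul_one,
    add_sub_assoc, ← Finset.sum_sub_distrib, Finset.sum_eq_zero, add_zero]
  intro w _
  unfold walkProb
  rw [← realDegree_eq_degree]
  by_cases hw : G.Adj u w
  · rw [if_pos hw, indicatorOf_pos hw]
    field_simp
    ring
  · rw [if_neg hw, indicatorOf_neg hw]
    ring

variable {R : V → V → ℝ}

/-- Both sides vanish at `u = v`, so it suffices to compare Laplacians off `v`. On the right the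
terms `c u` cancel, precisely because `c` does not depend on the second argument of `R`, and the
remaining delta picks out the degree of `u`. -/
theorem IsResistance.meanFirstPassage_eq (hR : IsResistance G R) (hG : G.Connected) (u v : V) :
    G.meanFirstPassage u v =
      (∑ w, G.realDegree w * (R u v + R v w - R u w)) / 2 := by
  obtain ⟨c, hc⟩ := hR.exists_laplacian
  refine congrFun (eq_of_laplacian_eq hG (f := fun x => G.meanFirstPassage x v)
    (g := fun x => (∑ w, G.realDegree w * (R x v + R v w - R x w)) / 2) (v := v) ?_ ?_) u
  · simp [meanFirstPassage_self, hR.self]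
  · intro u hu
    rw [laplacian_meanFirstPassage hG hu]
    simp_rw [div_eq_inv_mul]
    rw [laplacian_const_mul, laplacian_sum]
    simp_rw [laplacian_const_mul, laplacian_sub, laplacian_add, laplacian_const, hc]
    have h1 : ∀ w, G.realDegree w * (c u - 2 * indicatorOf (u = v) + 0
        - (c u - 2 * indicatorOf (u = w))) = 2 * (G.realDegree w * indicatorOf (u = w)) := by
      intro w
      rw [indicatorOf_neg hu]
      ring
    simp_rw [h1]
    rw [← Finset.mul_sum, sum_mul_indicatorOf_eq]
    ring

/-- The commute time identity: the terms `R v w - R u w` change sign when `u` and `v` are exchanged.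
-/
theorem IsResistance.meanFirstPassage_add (hR : IsResistance G R) (hG : G.Connected) (u v : V) :
    G.meanFirstPassage u v + G.meanFirstPassage v u = 2 * (G.numEdges : ℝ) * R u v := by
  rw [hR.meanFirstPassage_eq hG, hR.meanFirstPassage_eq hG, ← add_div,
    ← Finset.sum_add_distrib, ← G.sum_realDegree, Finset.sum_mul, Finset.sum_div]
  refine Finset.sum_congr rfl fun w _ => ?_
  rw [hR.symm v u]
  ring

theorem kemeny_eq_sum :
    G.kemeny = ∑ u, ∑ v, G.statDist u * G.meanFirstPassage u v * G.statDist v := by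
  classical
  unfold kemeny
  refine Finset.sum_congr rfl fun u _ => Finset.sum_subset (Finset.filter_subset _ _) ?_
  intro v _ hv
  have : v = u := by simpa using hv
  rw [this, meanFirstPassage_self, mul_zero, zero_mul]

theorem accessibility_eq_sum (v : V) :
    G.accessibility v = ∑ u, G.statDist u * G.meanFirstPassage u v := by
  classical
  unfold accessibility
  refine Finset.sum_subset (Finset.filter_subset _ _) ?_
  intro u _ hu
  have : u = v := by simpa using hu
  rw [this, meanFirstPassage_self, mul_zero]

/-- Symmetrising the double sum turns passage times into commute times. Without edges both sides are
`0`, by division by zero. -/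
theorem IsResistance.kemeny_eq (hR : IsResistance G R) (hG : G.Connected) :
    G.kemeny =
      (∑ u, ∑ v, G.realDegree u * G.realDegree v * R u v) / (4 * (G.numEdges : ℝ)) := by
  have h : 2 * G.kemeny = ∑ u, ∑ v, G.statDist u * G.statDist v *
      (G.meanFirstPassage u v + G.meanFirstPassage v u) := by
    rw [two_mul]
    nth_rewrite 2 [kemeny_eq_sum]
    rw [Finset.sum_comm, kemeny_eq_sum, ← Finset.sum_add_distrib]
    refine Finset.sum_congr rfl fun u _ => ?_
    rw [← Finset.sum_add_distrib]
    exact Finset.sum_congr rfl fun v _ => by ring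
  have h' : G.kemeny = (2 * G.kemeny) / 2 := by ring
  rw [h', h, Finset.sum_div, Finset.sum_div]
  refine Finset.sum_congr rfl fun u _ => ?_
  rw [Finset.sum_div, Finset.sum_div]
  refine Finset.sum_congr rfl fun v _ => ?_
  rw [hR.meanFirstPassage_add hG, statDist_eq, statDist_eq]
  by_cases hm : (G.numEdges : ℝ) = 0
  · simp [hm]
  · field_simp
    ring

/-- Put `S(v) = ∑ d_w R(w,v)`. Then `m_{u,v} = (2 m R(u,v) + S(v) - S(u)) / 2`; averaging over the
stationary `u`, the first two terms give `S(v) / 2` each and the last gives `κ`. -/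
theorem IsResistance.accessibility_eq (hR : IsResistance G R) (hG : G.Connected) (v : V) :
    G.accessibility v = ∑ w, G.realDegree w * R w v - G.kemeny := by
  rw [accessibility_eq_sum, hR.kemeny_eq hG]
  by_cases hm : (G.numEdges : ℝ) = 0
  · simp [statDist_eq, hm, G.realDegree_eq_zero_of_numEdges (by exact_mod_cast hm)]
  have h1 : ∀ u, G.statDist u * G.meanFirstPassage u v =
      G.realDegree u * R u v / 2 +
        G.realDegree u * (∑ w, G.realDegree w * R w v) / (4 * (G.numEdges : ℝ)) -
        (∑ w, G.realDegree u * G.realDegree w * R u w) / (4 * (G.numEdges : ℝ)) := by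
    intro u
    have h2 : ∑ w, G.realDegree w * (R u v + R v w - R u w) =
        2 * (G.numEdges : ℝ) * R u v + ∑ w, G.realDegree w * R w v
          - ∑ w, G.realDegree w * R u w := by
      rw [← G.sum_realDegree, Finset.sum_mul, ← Finset.sum_add_distrib,
        ← Finset.sum_sub_distrib]
      refine Finset.sum_congr rfl fun w _ => ?_
      rw [hR.symm v w]
      ring
    have h3 : ∑ w, G.realDegree u * G.realDegree w * R u w =
        G.realDegree u * ∑ w, G.realDegree w * R u w := by
      rw [Finset.mul_sum]
      exact Finset.sum_congr rfl fun w _ => by ring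
    rw [hR.meanFirstPassage_eq hG, statDist_eq, h2, h3]
    field_simp
    ring
  simp_rw [h1]
  rw [Finset.sum_sub_distrib, Finset.sum_add_distrib, ← Finset.sum_div, ← Finset.sum_div,
    ← Finset.sum_div, ← Finset.sum_mul, sum_realDegree]
  field_simp
  ring

end Resistance

/-! ### The two sides of an edge of a tree -/

section TreeSides

variable {ι : Type*} {T : SimpleGraph ι}

/-- `i` lies on the side of `q` with respect to the edge `p ∼ q`. -/
def OnSide (T : SimpleGraph ι) (p q i : ι) : Prop := (T.deleteEdges {s(p, q)}).Reachable q i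

theorem onSide_self (p q : ι) : T.OnSide p q q := Reachable.refl _

theorem OnSide.of_adj {p q i j : ι} (h : T.OnSide p q i) (hij : T.Adj i j)
    (hne : s(i, j) ≠ s(p, q)) : T.OnSide p q j :=
  h.trans (Adj.reachable (deleteEdges_adj.2 ⟨hij, hne⟩))

theorem onSide_iff_of_adj {p q i j : ι} (hij : T.Adj i j) (hne : s(i, j) ≠ s(p, q)) :
    T.OnSide p q i ↔ T.OnSide p q j :=
  ⟨fun h => h.of_adj hij hne, fun h => h.of_adj hij.symm (by rwa [Sym2.eq_swap])⟩

/-- Induction along a connected graph, from a base vertex. -/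
theorem Preconnected.induction_on_adj (hT : T.Preconnected) {P : ι → Prop} (a : ι) (ha : P a)
    (step : ∀ i j, T.Adj i j → P i → P j) (i : ι) : P i := by
  obtain ⟨p⟩ := hT a i
  induction p with
  | nil => exact ha
  | cons h _ ih => exact ih (step _ _ h ha)

theorem Reachable.induction_on_adj {a i : ι} (h : T.Reachable a i) {P : ι → Prop} (ha : P a)
    (step : ∀ i j, T.Reachable a i → T.Adj i j → P i → P j) : P i := by
  rw [reachable_iff_reflTransGen] at h
  induction h with
  | refl => exact ha
  | tail h1 h2 ih => exact step _ _ ((reachable_iff_reflTransGen _ _).2 h1) h2 ih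

theorem IsTree.onSide_or (hT : T.IsTree) (p q i : ι) : T.OnSide p q i ∨ T.OnSide q p i := by
  refine hT.connected.preconnected.induction_on_adj
    (P := fun i => T.OnSide p q i ∨ T.OnSide q p i) q (Or.inl (onSide_self p q)) ?_ i
  intro i j hij h
  by_cases he : s(i, j) = s(p, q)
  · rcases Sym2.eq_iff.1 he with ⟨-, rfl⟩ | ⟨-, rfl⟩
    · exact Or.inl (onSide_self _ _)
    · exact Or.inr (onSide_self _ _)
  · exact h.imp (fun h => h.of_adj hij he) fun h => h.of_adj hij (by rwa [Sym2.eq_swap (a := q)])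

theorem IsTree.not_onSide_and (hT : T.IsTree) {p q : ι} (hpq : T.Adj p q) (i : ι) :
    ¬ (T.OnSide p q i ∧ T.OnSide q p i) := by
  rintro ⟨h1, h2⟩
  have hb := isAcyclic_iff_forall_adj_isBridge.1 hT.isAcyclic hpq
  rw [isBridge_iff] at hb
  rw [OnSide, Sym2.eq_swap] at h2
  exact hb (h2.trans h1.symm)

theorem IsTree.not_onSide_left (hT : T.IsTree) {p q : ι} (hpq : T.Adj p q) :
    ¬ T.OnSide p q p := fun h => hT.not_onSide_and hpq p ⟨h, onSide_self q p⟩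

theorem IsTree.onSide_swap_iff (hT : T.IsTree) {p q : ι} (hpq : T.Adj p q) (i : ι) :
    T.OnSide q p i ↔ ¬ T.OnSide p q i :=
  ⟨fun h h' => hT.not_onSide_and hpq i ⟨h', h⟩, fun h => (hT.onSide_or p q i).resolve_left h⟩

theorem IsTree.exists_onSide (hT : T.IsTree) {l i : ι} (h : i ≠ l) :
    ∃ j, T.Adj l j ∧ T.OnSide l j i := by
  have key : i = l ∨ ∃ j, T.Adj l j ∧ T.OnSide l j i := by
    refine hT.connected.preconnected.induction_on_adj
      (P := fun i => i = l ∨ ∃ j, T.Adj l j ∧ T.OnSide l j i) l (Or.inl rfl) ?_ i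
    intro i j hij hi
    by_cases hj : j = l
    · exact Or.inl hj
    rcases hi with rfl | ⟨a, ha, hs⟩
    · exact Or.inr ⟨j, hij, onSide_self _ _⟩
    · by_cases hi : i = l
      · subst hi
        exact Or.inr ⟨j, hij, onSide_self _ _⟩
      · refine Or.inr ⟨a, ha, hs.of_adj hij fun he => ?_⟩
        rcases Sym2.eq_iff.1 he with ⟨h1, -⟩ | ⟨-, h1⟩
        · exact hi h1
        · exact hj h1
  exact key.resolve_left h

/-- If `j ≠ j'`, then `j'` is on the side of `l` for the edge `l ∼ j`. The branch beyond `j'` never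
meets `l`, so it cannot cross that edge, and `i` would lie on both of its sides. -/
theorem IsTree.onSide_unique (hT : T.IsTree) {l j j' i : ι} (hj : T.Adj l j) (hj' : T.Adj l j')
    (h : T.OnSide l j i) (h' : T.OnSide l j' i) : j = j' := by
  by_contra hne
  have hjl : T.OnSide j l j' := (onSide_self j l).of_adj hj' fun he => by
    rcases Sym2.eq_iff.1 he with ⟨h1, -⟩ | ⟨-, h1⟩
    · exact hj.ne h1
    · exact hne h1.symm
  have key : T.OnSide j l i := by
    refine Reachable.induction_on_adj (P := fun i => T.OnSide j l i) h' hjl ?_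
    intro a c ha hac hP
    have hne_l : ∀ x, T.OnSide l j' x → x ≠ l := by
      rintro x hx rfl
      exact hT.not_onSide_left hj' hx
    have hc : T.OnSide l j' c := Reachable.trans ha hac.reachable
    refine hP.of_adj (deleteEdges_adj.1 hac).1 fun he => ?_
    rcases Sym2.eq_iff.1 he with ⟨-, h1⟩ | ⟨h1, -⟩
    · exact hne_l c hc h1
    · exact hne_l a ha h1
  exact hT.not_onSide_and hj i ⟨h, key⟩

open scoped Classical in
/-- The neighbour of `l` in the direction of `i` (and `l` itself if there is none). -/
def nextVertex (T : SimpleGraph ι) (l i : ι) : ι :=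
  if h : ∃ j, T.Adj l j ∧ T.OnSide l j i then h.choose else l

theorem IsTree.nextVertex_eq (hT : T.IsTree) {l j i : ι} (hj : T.Adj l j) (h : T.OnSide l j i) :
    T.nextVertex l i = j := by
  have hex : ∃ j, T.Adj l j ∧ T.OnSide l j i := ⟨j, hj, h⟩
  rw [nextVertex, dif_pos hex]
  exact hT.onSide_unique hex.choose_spec.1 hj hex.choose_spec.2 h

end TreeSides

/-! ### Chains, their bridges and the projections to the constituents -/

section Chain

variable {ι : Type*} {T : SimpleGraph ι} {V : ι → Type*} {G : (i : ι) → SimpleGraph (V i)}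
  {b : (i j : ι) → V i}

theorem chain_adj_same (i : ι) (u w : V i) :
    (T.chain G b).Adj ⟨i, u⟩ ⟨i, w⟩ ↔ (G i).Adj u w := by
  constructor
  · rintro (⟨j, u', w', h, hx, hy⟩ | ⟨j, l, h, hx, hy⟩)
    · cases hx
      cases hy
      exact h
    · have h1 : i = j := congrArg Sigma.fst hx
      have h2 : i = l := congrArg Sigma.fst hy
      exact absurd (h1.symm.trans h2) h.ne
  · exact fun h => Or.inl ⟨i, u, w, h, rfl, rfl⟩

theorem chain_adj_of_ne {i j : ι} (hij : i ≠ j) (u : V i) (w : V j) :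
    (T.chain G b).Adj ⟨i, u⟩ ⟨j, w⟩ ↔ T.Adj i j ∧ b i j = u ∧ w = b j i := by
  constructor
  · rintro (⟨l, u', w', h, hx, hy⟩ | ⟨p, q, h, hx, hy⟩)
    · exact absurd ((congrArg Sigma.fst hx).trans (congrArg Sigma.fst hy).symm) hij
    · cases hx
      cases hy
      exact ⟨h, rfl, rfl⟩
  · rintro ⟨h, rfl, rfl⟩
    exact Or.inr ⟨i, j, h, rfl, rfl⟩

theorem chain_adj_bridge {i j : ι} (h : T.Adj i j) :
    (T.chain G b).Adj ⟨i, b i j⟩ ⟨j, b j i⟩ := Or.inr ⟨i, j, h, rfl, rfl⟩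

theorem reachable_sigma_of_hom {H : SimpleGraph (Σ i, V i)} {i : ι} (hG : (G i).Connected)
    (hom : ∀ u w : V i, (G i).Adj u w → H.Adj ⟨i, u⟩ ⟨i, w⟩) (u w : V i) :
    H.Reachable ⟨i, u⟩ ⟨i, w⟩ :=
  (hG.preconnected u w).map (⟨fun u => ⟨i, u⟩, fun h => hom _ _ h⟩ : G i →g H)

theorem chain_connected (hT : T.Connected) (hG : ∀ i, (G i).Connected) :
    (T.chain G b).Connected := by
  have hin : ∀ i (u w : V i), (T.chain G b).Reachable ⟨i, u⟩ ⟨i, w⟩ := fun i =>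
    reachable_sigma_of_hom (hG i) fun u w h => (chain_adj_same i u w).2 h
  obtain ⟨i⟩ := hT.nonempty
  have key : ∀ j (w : V j), (T.chain G b).Reachable ⟨i, b i i⟩ ⟨j, w⟩ := by
    refine hT.preconnected.induction_on_adj i (hin i _) ?_
    intro j l hjl h w
    exact ((h (b j l)).trans (chain_adj_bridge hjl).reachable).trans (hin l _ _)
  have : Nonempty (Σ i, V i) := ⟨⟨i, b i i⟩⟩
  exact ⟨fun x y => (key x.1 x.2).symm.trans (key y.1 y.2)⟩

/-- Walks project to `T`: a step inside a constituent keeps the index, and a step over another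
bridge follows another edge of `T`. Conversely, walks in `T` lift because the constituents are
connected. Thus `sideEdges` becomes a matter of sides in `T`. -/
theorem chain_deleteEdges_reachable_iff (hG : ∀ i, (G i).Connected)
    {i j : ι} (hij : T.Adj i j) (x : Σ i, V i) :
    ((T.chain G b).deleteEdges {s(⟨i, b i j⟩, ⟨j, b j i⟩)}).Reachable ⟨i, b i j⟩ x ↔
      T.OnSide j i x.1 := by
  have hmap : ∀ x y : Σ i, V i,
      s(x, y) = s(⟨i, b i j⟩, ⟨j, b j i⟩) → s(x.1, y.1) = s(i, j) := fun x y h => by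
    simpa using congrArg (Sym2.map Sigma.fst) h
  constructor
  · intro h
    refine Reachable.induction_on_adj (P := fun x => T.OnSide j i x.1) h (onSide_self _ _) ?_
    rintro ⟨p, u⟩ ⟨q, w⟩ - hadj hp
    obtain ⟨hadj, hne⟩ := deleteEdges_adj.1 hadj
    by_cases hpq : p = q
    · exact hpq ▸ hp
    obtain ⟨hT, rfl, rfl⟩ := (chain_adj_of_ne hpq u w).1 hadj
    refine hp.of_adj hT fun he => hne ?_
    rcases Sym2.eq_iff.1 he with ⟨rfl, rfl⟩ | ⟨rfl, rfl⟩
    · exact Sym2.eq_swap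
    · rfl
  · intro h
    have hin : ∀ l (u w : V l), ((T.chain G b).deleteEdges
        {s(⟨i, b i j⟩, ⟨j, b j i⟩)}).Reachable ⟨l, u⟩ ⟨l, w⟩ := fun l =>
      reachable_sigma_of_hom (hG l) fun u w h => deleteEdges_adj.2
        ⟨(chain_adj_same l u w).2 h, fun he => by
          rcases Sym2.eq_iff.1 (hmap _ _ he) with ⟨h1, h2⟩ | ⟨h1, h2⟩
          · exact hij.ne (h1.symm.trans h2)
          · exact hij.ne (h2.symm.trans h1)⟩
    have key : ∀ w : V x.1, ((T.chain G b).deleteEdges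
        {s(⟨i, b i j⟩, ⟨j, b j i⟩)}).Reachable ⟨i, b i j⟩ ⟨x.1, w⟩ := by
      refine Reachable.induction_on_adj (P := fun l => ∀ w : V l, ((T.chain G b).deleteEdges
        {s(⟨i, b i j⟩, ⟨j, b j i⟩)}).Reachable ⟨i, b i j⟩ ⟨l, w⟩) h (hin i _) ?_
      intro p q _ hpq hp w
      obtain ⟨hpq, hne⟩ := deleteEdges_adj.1 hpq
      refine ((hp (b p q)).trans (Adj.reachable (deleteEdges_adj.2
        ⟨chain_adj_bridge hpq, fun he => hne ?_⟩))).trans (hin q _ _)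
      have := hmap _ _ he
      simp only [Set.mem_singleton_iff]
      rw [this, Sym2.eq_swap]
    exact key x.2

/-- The indicator of a side of an edge of `T`. -/
def sideInd (T : SimpleGraph ι) (p q i : ι) : ℝ := indicatorOf (T.OnSide p q i)

theorem IsTree.sideInd_add_swap (hT : T.IsTree) {p q : ι} (hpq : T.Adj p q) (i : ι) :
    T.sideInd p q i + T.sideInd q p i = 1 := by
  unfold sideInd
  rw [indicatorOf_congr (hT.onSide_swap_iff hpq i)]
  by_cases h : T.OnSide p q i <;> simp [indicatorOf, h]

open scoped Classical in
/-- The projection of a chain onto one of its constituents: the vertices outside `G l` are sent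
to the vertex through which `G l` is entered from them. -/
def chainProj (T : SimpleGraph ι) (b : (i j : ι) → V i) (l : ι) (x : Σ i, V i) : V l :=
  if h : x.1 = l then h ▸ x.2 else b l (T.nextVertex l x.1)

theorem chainProj_self (l : ι) (u : V l) : T.chainProj b l ⟨l, u⟩ = u := by
  simp [chainProj]

theorem IsTree.chainProj_of_onSide (hT : T.IsTree) {l j : ι} (hj : T.Adj l j) {x : Σ i, V i}
    (h : T.OnSide l j x.1) : T.chainProj b l x = b l j := by
  have hne : x.1 ≠ l := fun he => hT.not_onSide_left hj (he ▸ h)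
  rw [chainProj, dif_neg hne, hT.nextVertex_eq hj h]

/-- If one end lies in `G l`, the other is projected onto it; otherwise both ends lie in the same
branch at `l`. Hence crossing a bridge leaves every constituent's resistance term unchanged. -/
theorem IsTree.chainProj_bridge (hT : T.IsTree) {i j : ι} (hij : T.Adj i j) (l : ι) :
    T.chainProj b l ⟨i, b i j⟩ = T.chainProj b l ⟨j, b j i⟩ := by
  by_cases hi : i = l
  · subst hi
    rw [chainProj_self, hT.chainProj_of_onSide hij (onSide_self i j)]
  by_cases hj : j = l
  · subst hj
    rw [chainProj_self, hT.chainProj_of_onSide hij.symm (onSide_self j i)]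
  obtain ⟨a, ha, hs⟩ := hT.exists_onSide hi
  have hs' : T.OnSide l a j := hs.of_adj hij fun he => by
    rcases Sym2.eq_iff.1 he with ⟨h1, -⟩ | ⟨-, h1⟩
    · exact hi h1
    · exact hj h1
  rw [hT.chainProj_of_onSide ha hs, hT.chainProj_of_onSide ha hs']

theorem chainProj_eq_of_ne {i l : ι} (h : i ≠ l) (u w : V i) :
    T.chainProj b l ⟨i, u⟩ = T.chainProj b l ⟨i, w⟩ := by
  rw [chainProj, chainProj, dif_neg h, dif_neg h]

variable [Fintype ι]

/-- The vertices outside `G l`, sorted by the bridge through which `G l` is entered. -/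
theorem IsTree.sum_sideInd_mul (hT : T.IsTree) {l : ι} (f : V l → ℝ) {x : Σ i, V i}
    (hx : x.1 ≠ l) :
    ∑ j, indicatorOf (T.Adj l j) * (T.sideInd l j x.1 * f (b l j)) = f (T.chainProj b l x) := by
  obtain ⟨j, hj, hs⟩ := hT.exists_onSide hx
  rw [hT.chainProj_of_onSide hj hs, Finset.sum_eq_single j, indicatorOf_pos hj, sideInd,
    indicatorOf_pos hs, one_mul, one_mul]
  · intro a _ ha
    by_cases hla : T.Adj l a
    · rw [sideInd, indicatorOf_neg fun h => ha (hT.onSide_unique hla hj h hs)]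
      ring
    · rw [indicatorOf_neg hla, zero_mul]
  · simp

theorem IsTree.sum_sideInd_mul_self (hT : T.IsTree) (l : ι) (f : V l → ℝ) :
    ∑ j, indicatorOf (T.Adj l j) * (T.sideInd l j l * f (b l j)) = 0 := by
  refine Finset.sum_eq_zero fun j _ => ?_
  by_cases hj : T.Adj l j
  · rw [sideInd, indicatorOf_neg (hT.not_onSide_left hj)]
    ring
  · rw [indicatorOf_neg hj, zero_mul]

variable [∀ i, Fintype (V i)]

/-- A sum over the neighbours of a vertex of a chain. -/
theorem sum_chain_adj (i : ι) (u : V i) (F : (Σ i, V i) → ℝ) :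
    ∑ y, indicatorOf ((T.chain G b).Adj ⟨i, u⟩ y) * F y =
      ∑ w, indicatorOf ((G i).Adj u w) * F ⟨i, w⟩ +
        ∑ j, indicatorOf (T.Adj i j) * (indicatorOf (b i j = u) * F ⟨j, b j i⟩) := by
  classical
  rw [Fintype.sum_sigma, Fintype.sum_eq_add_sum_compl i,
    Fintype.sum_eq_add_sum_compl (f := fun j => indicatorOf (T.Adj i j) * _) i,
    indicatorOf_neg (T.loopless.irrefl i), zero_mul, zero_add]
  congr 1
  · exact Finset.sum_congr rfl fun w _ => by rw [indicatorOf_congr (chain_adj_same i u w)]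
  · refine Finset.sum_congr rfl fun j hj => ?_
    have hij : i ≠ j := by
      rintro rfl
      simp at hj
    have : ∀ w, indicatorOf ((T.chain G b).Adj ⟨i, u⟩ ⟨j, w⟩) * F ⟨j, w⟩ =
        indicatorOf (w = b j i) * (indicatorOf (T.Adj i j) * (indicatorOf (b i j = u) *
          F ⟨j, w⟩)) := by
      intro w
      rw [indicatorOf_congr (chain_adj_of_ne hij u w)]
      by_cases h1 : T.Adj i j <;> by_cases h2 : b i j = u <;> by_cases h3 : w = b j i <;>
        simp [indicatorOf, h1, h2, h3]
    simp_rw [this]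
    exact sum_indicatorOf_eq_mul (b j i) fun w =>
      indicatorOf (T.Adj i j) * (indicatorOf (b i j = u) * F ⟨j, w⟩)

theorem realDegree_chain (i : ι) (u : V i) :
    (T.chain G b).realDegree ⟨i, u⟩ =
      (G i).realDegree u + ∑ j, indicatorOf (T.Adj i j) * indicatorOf (b i j = u) := by
  simpa [realDegree] using sum_chain_adj (T := T) (G := G) (b := b) i u fun _ => 1

theorem laplacian_chain (F : (Σ i, V i) → ℝ) (i : ι) (u : V i) :
    (T.chain G b).laplacian F ⟨i, u⟩ = (G i).laplacian (fun w => F ⟨i, w⟩) u +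
      ∑ j, indicatorOf (T.Adj i j) * (indicatorOf (b i j = u) *
        (F ⟨i, u⟩ - F ⟨j, b j i⟩)) :=
  sum_chain_adj i u fun y => F ⟨i, u⟩ - F y

/-- The number of edges on one side of a bridge, as a degree sum. -/
theorem sum_realDegree_mul_sideInd (hT : T.IsTree) (hG : ∀ i, (G i).Connected) {i j : ι}
    (hij : T.Adj i j) :
    ∑ x, (T.chain G b).realDegree x * T.sideInd j i x.1 =
      2 * ((T.chain G b).sideEdges ⟨i, b i j⟩ ⟨j, b j i⟩ : ℝ) + 1 := by
  classical
  -- `H` consists of the edges counted by `sideEdges`, so the handshake lemma applies to it.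
  set H : SimpleGraph (Σ i, V i) :=
    { Adj := fun x y => ((T.chain G b).deleteEdges
          {s((⟨i, b i j⟩ : Σ i, V i), (⟨j, b j i⟩ : Σ i, V i))}).Adj x y ∧
        T.OnSide j i x.1 ∧ T.OnSide j i y.1
      symm := ⟨fun x y h => ⟨h.1.symm, h.2.2, h.2.1⟩⟩
      loopless := ⟨fun x h => h.1.ne rfl⟩ } with hH
  have hcard : (T.chain G b).sideEdges ⟨i, b i j⟩ ⟨j, b j i⟩ = H.numEdges := by
    unfold sideEdges numEdges
    rw [← Set.ncard_coe_finset, coe_edgeFinset]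
    congr 1
    ext e
    induction e using Sym2.ind with
    | _ x y =>
      simp only [Set.mem_ofPred_eq, mem_edgeSet, Sym2.mem_iff, forall_eq_or_imp, forall_eq,
        chain_deleteEdges_reachable_iff hG hij, hH]
  -- The degrees on this side are those of `H`, except that the deleted bridge adds one at its end;
  -- this is the `+ 1` of the statement.
  have hpt : ∀ x, (T.chain G b).realDegree x * T.sideInd j i x.1 =
      H.realDegree x + indicatorOf (x = ⟨i, b i j⟩) * 1 := by
    intro x
    have hone : indicatorOf (x = ⟨i, b i j⟩) * 1 =
        ∑ y : (Σ i, V i), indicatorOf (x = ⟨i, b i j⟩ ∧ y = ⟨j, b j i⟩) := by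
      by_cases hx : x = ⟨i, b i j⟩
      · rw [indicatorOf_pos hx]
        simpa [hx] using (sum_indicatorOf_eq_mul (⟨j, b j i⟩ : Σ i, V i) fun _ => 1).symm
      · simp [indicatorOf, hx]
    rw [hone, realDegree, realDegree, Finset.sum_mul, ← Finset.sum_add_distrib]
    refine Finset.sum_congr rfl fun y _ => ?_
    rw [sideInd]
    by_cases hxy : x = ⟨i, b i j⟩ ∧ y = ⟨j, b j i⟩
    · obtain ⟨rfl, rfl⟩ := hxy
      have hnot : ¬ H.Adj ⟨i, b i j⟩ ⟨j, b j i⟩ := fun h => (deleteEdges_adj.1 h.1).2 rfl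
      rw [indicatorOf_pos (chain_adj_bridge hij), indicatorOf_pos (onSide_self j i),
        indicatorOf_neg hnot, indicatorOf_pos ⟨rfl, rfl⟩, zero_add, mul_one]
    · rw [indicatorOf_neg hxy, add_zero]
      by_cases hx : T.OnSide j i x.1
      · rw [indicatorOf_pos hx, mul_one]
        refine indicatorOf_congr ⟨fun h => ?_, fun h => (deleteEdges_adj.1 h.1).1⟩
        have hne : s(x, y) ≠ s(⟨i, b i j⟩, ⟨j, b j i⟩) := by
          intro he
          rcases Sym2.eq_iff.1 he with h1 | ⟨rfl, -⟩
          · exact hxy h1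
          · exact hT.not_onSide_left hij.symm hx
        have hdel : ((T.chain G b).deleteEdges {s(⟨i, b i j⟩, ⟨j, b j i⟩)}).Adj x y :=
          deleteEdges_adj.2 ⟨h, hne⟩
        exact ⟨hdel, hx, (chain_deleteEdges_reachable_iff hG hij y).1
          (((chain_deleteEdges_reachable_iff hG hij x).2 hx).trans hdel.reachable)⟩
      · rw [indicatorOf_neg hx, mul_zero, indicatorOf_neg]
        exact fun h => hx h.2.1
  simp_rw [hpt]
  rw [Finset.sum_add_distrib, sum_realDegree, hcard, sum_indicatorOf_eq_mul]

/-- The degree sum over the far side of a bridge. -/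
theorem sum_realDegree_mul_sideInd_eq_chainWbar (hT : T.IsTree) (hG : ∀ i, (G i).Connected)
    {i j : ι} (hij : T.Adj i j) :
    ∑ x, (T.chain G b).realDegree x * T.sideInd i j x.1 = 2 * T.chainWbar G b i j - 1 := by
  have h1 := sum_realDegree_mul_sideInd (b := b) hT hG hij
  -- The two sides partition the vertices, and `2 m - (2 W + 1) = 2 W̄ - 1`.
  have h2 : ∑ x, (T.chain G b).realDegree x * T.sideInd i j x.1 +
      ∑ x, (T.chain G b).realDegree x * T.sideInd j i x.1 =
        2 * ((T.chain G b).numEdges : ℝ) := by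
    rw [← sum_realDegree, ← Finset.sum_add_distrib]
    refine Finset.sum_congr rfl fun x _ => ?_
    rw [← mul_add, hT.sideInd_add_swap hij, mul_one]
  unfold chainWbar coSideEdges
  linarith

theorem chainWbar_nonneg (hT : T.IsTree) (hG : ∀ i, (G i).Connected) {i j : ι}
    (hij : T.Adj i j) : 0 ≤ T.chainWbar G b i j := by
  have h1 := sum_realDegree_mul_sideInd_eq_chainWbar (b := b) hT hG hij
  have h2 : 0 ≤ ∑ x, (T.chain G b).realDegree x * T.sideInd i j x.1 :=
    Finset.sum_nonneg fun x _ => mul_nonneg (realDegree_nonneg _ _) (indicatorOf_nonneg _)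
  linarith

/-- The image of the degree measure of a chain under the projection onto a constituent. -/
theorem sum_realDegree_mul_chainProj (hT : T.IsTree) (hG : ∀ i, (G i).Connected) (l : ι)
    (f : V l → ℝ) :
    ∑ x, (T.chain G b).realDegree x * f (T.chainProj b l x) =
      ∑ u, (G l).realDegree u * f u +
        ∑ j, indicatorOf (T.Adj l j) * (2 * T.chainWbar G b l j * f (b l j)) := by
  classical
  have h1 : ∑ x, (T.chain G b).realDegree x * f (T.chainProj b l x) =
      ∑ u, (T.chain G b).realDegree ⟨l, u⟩ * f u +
        ∑ x, (T.chain G b).realDegree x *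
          ∑ j, indicatorOf (T.Adj l j) * (T.sideInd l j x.1 * f (b l j)) := by
    rw [Fintype.sum_sigma, Fintype.sum_sigma, Fintype.sum_eq_add_sum_compl l,
      Fintype.sum_eq_add_sum_compl (f := fun i => ∑ u : V i, _ * ∑ j, _) l]
    rw [Finset.sum_eq_zero (s := (Finset.univ : Finset (V l)))
      (f := fun u => (T.chain G b).realDegree ⟨l, u⟩ * ∑ j, _), zero_add]
    · congr 1
      · exact Finset.sum_congr rfl fun u _ => by rw [chainProj_self]
      · refine Finset.sum_congr rfl fun i hi => Finset.sum_congr rfl fun u _ => ?_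
        have hil : i ≠ l := by
          rintro rfl
          simp at hi
        rw [hT.sum_sideInd_mul f (x := ⟨i, u⟩) hil]
    · intro u _
      rw [hT.sum_sideInd_mul_self, mul_zero]
  have h2 : ∑ x, (T.chain G b).realDegree x *
      ∑ j, indicatorOf (T.Adj l j) * (T.sideInd l j x.1 * f (b l j)) =
      ∑ j, indicatorOf (T.Adj l j) * ((2 * T.chainWbar G b l j - 1) * f (b l j)) := by
    simp_rw [Finset.mul_sum]
    rw [Finset.sum_comm]
    refine Finset.sum_congr rfl fun j _ => ?_
    by_cases hj : T.Adj l j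
    · rw [← sum_realDegree_mul_sideInd_eq_chainWbar hT hG hj, Finset.sum_mul, Finset.mul_sum]
      exact Finset.sum_congr rfl fun x _ => by ring
    · simp [indicatorOf_neg hj]
  -- Each bridge at `G l` adds one to the degree of its end there, which completes the far-side mass
  -- `2 W̄ - 1` to `2 W̄`.
  have h3 : ∑ u, (T.chain G b).realDegree ⟨l, u⟩ * f u =
      ∑ u, (G l).realDegree u * f u + ∑ j, indicatorOf (T.Adj l j) * f (b l j) := by
    simp_rw [realDegree_chain, add_mul, Finset.sum_add_distrib, Finset.sum_mul]
    congr 1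
    rw [Finset.sum_comm]
    refine Finset.sum_congr rfl fun j _ => ?_
    rw [← sum_mul_indicatorOf_eq (b l j) f, Finset.mul_sum]
    exact Finset.sum_congr rfl fun u _ => by ring
  rw [h1, h2, h3, add_assoc, ← Finset.sum_add_distrib]
  congr 1
  exact Finset.sum_congr rfl fun j _ => by ring

/-! ### Separating edges and the resistance of a chain -/

/-- The number of edges of a tree that separate two vertices. -/
def separation (T : SimpleGraph ι) (i j : ι) : ℝ :=
  ∑ p, ∑ q, indicatorOf (T.Adj p q) * (T.sideInd p q i * T.sideInd q p j)

theorem separation_comm (i j : ι) : T.separation i j = T.separation j i := by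
  unfold separation
  rw [Finset.sum_comm]
  refine Finset.sum_congr rfl fun p _ => Finset.sum_congr rfl fun q _ => ?_
  rw [indicatorOf_congr (T.adj_comm q p)]
  ring

theorem IsTree.separation_self (hT : T.IsTree) (i : ι) : T.separation i i = 0 := by
  refine Finset.sum_eq_zero fun p _ => Finset.sum_eq_zero fun q _ => ?_
  by_cases h : T.Adj p q
  · unfold sideInd
    rw [indicatorOf_congr (hT.onSide_swap_iff h i)]
    by_cases h' : T.OnSide p q i <;> simp [indicatorOf, h']
  · rw [indicatorOf_neg h, zero_mul]

/-- Only the edge `i ∼ j` has `i` and `j` on different sides, so just its two orientations survive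
in the difference, and their indicators at `a` add up to one. -/
theorem IsTree.separation_sub (hT : T.IsTree) {i j : ι} (hij : T.Adj i j) (a : ι) :
    T.separation i a - T.separation j a = 2 * T.sideInd i j a - 1 := by
  classical
  have key : ∀ p q, indicatorOf (T.Adj p q) * (T.sideInd p q i * T.sideInd q p a) -
      indicatorOf (T.Adj p q) * (T.sideInd p q j * T.sideInd q p a) =
      indicatorOf (q = i) * (indicatorOf (p = j) * T.sideInd q p a) -
        indicatorOf (q = j) * (indicatorOf (p = i) * T.sideInd q p a) := by
    intro p q
    by_cases he : s(i, j) = s(p, q)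
    · rcases Sym2.eq_iff.1 he with ⟨rfl, rfl⟩ | ⟨rfl, rfl⟩
      · simp [sideInd, indicatorOf, hij, hij.ne, hij.ne', hT.not_onSide_left hij, onSide_self]
      · simp [sideInd, indicatorOf, hij.symm, hij.ne, hij.ne', hT.not_onSide_left hij.symm,
          onSide_self]
    · have h1 : ¬ (q = i ∧ p = j) := by
        rintro ⟨rfl, rfl⟩
        exact he Sym2.eq_swap
      have h2 : ¬ (q = j ∧ p = i) := by
        rintro ⟨rfl, rfl⟩
        exact he rfl
      have h3 : T.sideInd p q i = T.sideInd p q j := indicatorOf_congr (onSide_iff_of_adj hij he)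
      rw [h3, sub_self]
      by_cases hqi : q = i
      · have hpj : p ≠ j := fun h => h1 ⟨hqi, h⟩
        have hqj : q ≠ j := fun h => hij.ne (hqi.symm.trans h)
        simp [indicatorOf, hpj, hqj]
      · by_cases hqj : q = j
        · have hpi : p ≠ i := fun h => h2 ⟨hqj, h⟩
          simp [indicatorOf, hqi, hpi]
        · simp [indicatorOf, hqi, hqj]
  unfold separation
  rw [← Finset.sum_sub_distrib]
  simp_rw [← Finset.sum_sub_distrib, key, Finset.sum_sub_distrib]
  simp_rw [sum_indicatorOf_eq_mul]
  linarith [hT.sideInd_add_swap hij a, sum_indicatorOf_eq_mul j fun p => T.sideInd i p a,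
    sum_indicatorOf_eq_mul i fun p => T.sideInd j p a]

/-- The resistances of a chain, from those of its constituents. -/
def chainResistance (T : SimpleGraph ι) (b : (i j : ι) → V i) (R : (i : ι) → V i → V i → ℝ)
    (x y : Σ i, V i) : ℝ :=
  ∑ l, R l (T.chainProj b l x) (T.chainProj b l y) + T.separation x.1 y.1

/-- Edges inside `G i` see only the summand `R i`, and bridges see only the separation. The former
give a delta at the projection of `y`, which the latter correct to a delta at `y` itself; the
constant `c` drops by the number of bridges at the vertex. -/
theorem isResistance_chainResistance (hT : T.IsTree) {R : (i : ι) → V i → V i → ℝ}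
    (hR : ∀ i, IsResistance (G i) (R i)) :
    IsResistance (T.chain G b) (T.chainResistance b R) := by
  classical
  choose c hc using fun i => (hR i).exists_laplacian
  refine ⟨fun x y => ?_, fun x => ?_,
    fun x => c x.1 x.2 - ∑ j, indicatorOf (T.Adj x.1 j) * indicatorOf (b x.1 j = x.2), ?_⟩
  · rw [chainResistance, chainResistance, separation_comm]
    congr 1
    exact Finset.sum_congr rfl fun l _ => (hR l).symm _ _
  · rw [chainResistance, hT.separation_self, add_zero]
    exact Finset.sum_eq_zero fun l _ => (hR l).self _
  · rintro ⟨i, u⟩ y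
    rw [laplacian_chain]
    have h1 : (G i).laplacian (fun w => T.chainResistance b R ⟨i, w⟩ y) u =
        c i u - 2 * indicatorOf (u = T.chainProj b i y) := by
      have : (fun w => T.chainResistance b R ⟨i, w⟩ y) =
          fun w => R i w (T.chainProj b i y) + (∑ l ∈ {i}ᶜ,
            R l (T.chainProj b l ⟨i, u⟩) (T.chainProj b l y) + T.separation i y.1) := by
        funext w
        rw [chainResistance, Fintype.sum_eq_add_sum_compl i, chainProj_self, add_assoc]
        congr 2
        refine Finset.sum_congr rfl fun l hl => ?_
        have hil : i ≠ l := by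
          rintro rfl
          simp at hl
        rw [chainProj_eq_of_ne hil w u]
      rw [this, laplacian_add, laplacian_const, add_zero, hc]
    have h2 : ∀ j, indicatorOf (T.Adj i j) * (indicatorOf (b i j = u) *
        (T.chainResistance b R ⟨i, u⟩ y - T.chainResistance b R ⟨j, b j i⟩ y)) =
        2 * (indicatorOf (T.Adj i j) * (T.sideInd i j y.1 * indicatorOf (b i j = u)))
          - indicatorOf (T.Adj i j) * indicatorOf (b i j = u) := by
      intro j
      by_cases hij : T.Adj i j
      · by_cases hu : b i j = u
        · subst hu
          have : T.chainResistance b R ⟨i, b i j⟩ y - T.chainResistance b R ⟨j, b j i⟩ y =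
              2 * T.sideInd i j y.1 - 1 := by
            rw [← hT.separation_sub hij, chainResistance, chainResistance]
            simp_rw [hT.chainProj_bridge hij]
            ring
          rw [this]
          rw [indicatorOf_pos hij, indicatorOf_pos rfl]
          ring
        · simp [indicatorOf_neg hu]
      · simp [indicatorOf_neg hij]
    simp_rw [h2]
    rw [h1, Finset.sum_sub_distrib, ← Finset.mul_sum]
    -- For `y` in `G i` no bridge at `G i` has `y` beyond it. Otherwise exactly one has, and its end
    -- in `G i` is the projection of `y`.
    have h3 : ∑ j, indicatorOf (T.Adj i j) * (T.sideInd i j y.1 * indicatorOf (b i j = u)) =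
        indicatorOf (u = T.chainProj b i y) - indicatorOf ((⟨i, u⟩ : Σ i, V i) = y) := by
      by_cases hy : y.1 = i
      · obtain ⟨i', w⟩ := y
        obtain rfl : i' = i := hy
        rw [hT.sum_sideInd_mul_self i' fun z => indicatorOf (z = u), chainProj_self]
        rw [indicatorOf_congr (p := (⟨i', u⟩ : Σ i, V i) = ⟨i', w⟩) (q := u = w) (by simp),
          sub_self]
      · rw [hT.sum_sideInd_mul (fun z => indicatorOf (z = u)) hy,
          indicatorOf_neg (p := (⟨i, u⟩ : Σ i, V i) = y) (by rintro rfl; exact hy rfl), sub_zero]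
        exact indicatorOf_congr eq_comm
    rw [h3]
    ring

end Chain

/-! ### Kemeny's constant of a chain -/

section ChainKemeny

variable {ι : Type*} [Fintype ι] {T : SimpleGraph ι} {V : ι → Type*} [∀ i, Fintype (V i)]
  {G : (i : ι) → SimpleGraph (V i)} {b : (i j : ι) → V i}

/-- The edges of a chain, sorted by the bridges at one of its constituents. -/
theorem numEdges_chain (hT : T.IsTree) (hG : ∀ i, (G i).Connected) (l : ι) :
    ((T.chain G b).numEdges : ℝ) =
      (G l).numEdges + ∑ j, indicatorOf (T.Adj l j) * T.chainWbar G b l j := by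
  have h := sum_realDegree_mul_chainProj (b := b) hT hG l fun _ => 1
  simp only [mul_one, sum_realDegree] at h
  have h2 : ∑ j, indicatorOf (T.Adj l j) * (2 * T.chainWbar G b l j) =
      2 * ∑ j, indicatorOf (T.Adj l j) * T.chainWbar G b l j := by
    rw [Finset.mul_sum]
    exact Finset.sum_congr rfl fun j _ => by ring
  linarith

theorem numEdges_eq_zero_of_chain (hT : T.IsTree) (hG : ∀ i, (G i).Connected)
    (h : ((T.chain G b).numEdges : ℝ) = 0) (l : ι) : ((G l).numEdges : ℝ) = 0 := by
  have h1 := numEdges_chain (b := b) hT hG l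
  have h2 : 0 ≤ ∑ j, indicatorOf (T.Adj l j) * T.chainWbar G b l j := by
    refine Finset.sum_nonneg fun j _ => ?_
    by_cases hj : T.Adj l j
    · exact mul_nonneg (indicatorOf_nonneg _) (chainWbar_nonneg hT hG hj)
    · rw [indicatorOf_neg hj, zero_mul]
  have h3 : (0 : ℝ) ≤ (G l).numEdges := Nat.cast_nonneg _
  linarith

/-- A connected graph without edges has a single vertex. -/
theorem IsResistance.eq_zero_of_numEdges {W : Type*} [Fintype W] {H : SimpleGraph W}
    {R : W → W → ℝ} (hR : IsResistance H R) (hH : H.Connected) (h : (H.numEdges : ℝ) = 0)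
    (u v : W) : R u v = 0 := by
  classical
  by_cases huv : u = v
  · rw [huv, hR.self]
  · have : Nontrivial W := ⟨u, v, huv⟩
    have h1 := H.realDegree_eq_zero_of_numEdges (by exact_mod_cast h) u
    rw [realDegree_eq_degree] at h1
    have h2 := hH.preconnected.degree_pos_of_nontrivial u
    have h3 : H.degree u = 0 := by exact_mod_cast h1
    omega

theorem IsResistance.sum_sum_eq {W : Type*} [Fintype W] {H : SimpleGraph W}
    {R : W → W → ℝ} (hR : IsResistance H R) (hH : H.Connected) :
    ∑ u, ∑ v, H.realDegree u * H.realDegree v * R u v = 4 * (H.numEdges : ℝ) * H.kemeny := by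
  rw [hR.kemeny_eq hH]
  by_cases h : (H.numEdges : ℝ) = 0
  · simp [hR.eq_zero_of_numEdges hH h]
  · field_simp

/-- The degree measure is pushed forward in `y` and then in `x`. Both cross terms contain `α + κ`;
by `numEdges_chain` their `κ` parts raise the coefficient of `κ(G l)` from the edge count of `G l`
to that of the chain. -/
theorem sum_sum_realDegree_mul_resistance_chainProj (hT : T.IsTree)
    (hG : ∀ i, (G i).Connected) {l : ι} {R : V l → V l → ℝ} (hR : IsResistance (G l) R) :
    ∑ x, ∑ y, (T.chain G b).realDegree x * (T.chain G b).realDegree y *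
        R (T.chainProj b l x) (T.chainProj b l y) =
      4 * ((T.chain G b).numEdges * (G l).kemeny +
        ∑ j, indicatorOf (T.Adj l j) *
          (T.chainWbar G b l j * (G l).accessibility (b l j)) +
        ∑ j, indicatorOf (T.Adj l j) * ∑ j', indicatorOf (T.Adj l j') *
          (T.chainWbar G b l j * T.chainWbar G b l j' * R (b l j) (b l j'))) := by
  have h1 : ∑ x, ∑ y, (T.chain G b).realDegree x * (T.chain G b).realDegree y *
        R (T.chainProj b l x) (T.chainProj b l y) =
      ∑ x, (T.chain G b).realDegree x * (∑ u, (G l).realDegree u * R (T.chainProj b l x) u +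
        ∑ j, indicatorOf (T.Adj l j) *
          (2 * T.chainWbar G b l j * R (T.chainProj b l x) (b l j))) := by
    refine Finset.sum_congr rfl fun x _ => ?_
    rw [← sum_realDegree_mul_chainProj hT hG l fun u => R (T.chainProj b l x) u, Finset.mul_sum]
    exact Finset.sum_congr rfl fun y _ => by ring
  have hα : ∀ v, ∑ u, (G l).realDegree u * R v u = (G l).accessibility v + (G l).kemeny := by
    intro v
    rw [hR.accessibility_eq (hG l), sub_add_cancel]
    exact Finset.sum_congr rfl fun u _ => by rw [hR.symm]
  have hα' : ∀ v, ∑ u, (G l).realDegree u * R u v = (G l).accessibility v + (G l).kemeny := by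
    intro v
    rw [hR.accessibility_eq (hG l), sub_add_cancel]
  have h2 : ∑ u, (G l).realDegree u * (∑ w, (G l).realDegree w * R u w) =
      4 * ((G l).numEdges : ℝ) * (G l).kemeny := by
    rw [← hR.sum_sum_eq (hG l)]
    refine Finset.sum_congr rfl fun u _ => ?_
    rw [Finset.mul_sum]
    exact Finset.sum_congr rfl fun w _ => by ring
  have h3 : ∑ u, (G l).realDegree u * (∑ j, indicatorOf (T.Adj l j) *
        (2 * T.chainWbar G b l j * R u (b l j))) =
      ∑ j, indicatorOf (T.Adj l j) * (2 * T.chainWbar G b l j *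
        ((G l).accessibility (b l j) + (G l).kemeny)) := by
    simp_rw [Finset.mul_sum]
    rw [Finset.sum_comm]
    refine Finset.sum_congr rfl fun j _ => ?_
    rw [← hα', Finset.mul_sum, Finset.mul_sum]
    exact Finset.sum_congr rfl fun u _ => by ring
  rw [h1, sum_realDegree_mul_chainProj hT hG l fun v => ∑ u, (G l).realDegree u * R v u +
    ∑ j, indicatorOf (T.Adj l j) * (2 * T.chainWbar G b l j * R v (b l j)),
    numEdges_chain hT hG l]
  simp_rw [mul_add ((G l).realDegree _), Finset.sum_add_distrib]
  rw [h2, h3]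
  have h4 : ∀ j, indicatorOf (T.Adj l j) * (2 * T.chainWbar G b l j *
      (∑ u, (G l).realDegree u * R (b l j) u + ∑ j', indicatorOf (T.Adj l j') *
        (2 * T.chainWbar G b l j' * R (b l j) (b l j')))) =
      2 * (indicatorOf (T.Adj l j) * T.chainWbar G b l j * (G l).kemeny) +
      2 * (indicatorOf (T.Adj l j) * (T.chainWbar G b l j * (G l).accessibility (b l j))) +
      4 * (indicatorOf (T.Adj l j) * ∑ j', indicatorOf (T.Adj l j') *
        (T.chainWbar G b l j * T.chainWbar G b l j' * R (b l j) (b l j'))) := by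
    intro j
    have : ∑ j', indicatorOf (T.Adj l j') *
        (T.chainWbar G b l j * T.chainWbar G b l j' * R (b l j) (b l j')) =
        T.chainWbar G b l j / 2 * ∑ j', indicatorOf (T.Adj l j') *
          (2 * T.chainWbar G b l j' * R (b l j) (b l j')) := by
      rw [Finset.mul_sum]
      exact Finset.sum_congr rfl fun j' _ => by ring
    rw [hα, this]
    ring
  have h5 : ∀ j, indicatorOf (T.Adj l j) * (2 * T.chainWbar G b l j *
      ((G l).accessibility (b l j) + (G l).kemeny)) =
      2 * (indicatorOf (T.Adj l j) * T.chainWbar G b l j * (G l).kemeny) +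
      2 * (indicatorOf (T.Adj l j) * (T.chainWbar G b l j * (G l).accessibility (b l j))) :=
    fun j => by ring
  simp_rw [h4, h5, Finset.sum_add_distrib, ← Finset.mul_sum, ← Finset.sum_mul]
  ring

/-- For a fixed oriented edge the double sum factors into the degree sums over its two sides. -/
theorem sum_sum_realDegree_mul_separation (hT : T.IsTree) (hG : ∀ i, (G i).Connected) :
    ∑ x, ∑ y, (T.chain G b).realDegree x * (T.chain G b).realDegree y *
        T.separation x.1 y.1 =
      ∑ p, ∑ q, indicatorOf (T.Adj p q) *
        ((2 * T.chainWbar G b p q - 1) * (2 * T.chainWbar G b q p - 1)) := by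
  have h : ∀ x y : (Σ i, V i), (T.chain G b).realDegree x * (T.chain G b).realDegree y *
      T.separation x.1 y.1 = ∑ p, ∑ q, indicatorOf (T.Adj p q) *
        (((T.chain G b).realDegree x * T.sideInd p q x.1) *
          ((T.chain G b).realDegree y * T.sideInd q p y.1)) := by
    intro x y
    rw [separation, Finset.mul_sum]
    refine Finset.sum_congr rfl fun p _ => ?_
    rw [Finset.mul_sum]
    exact Finset.sum_congr rfl fun q _ => by ring
  simp_rw [h]
  simp_rw [Finset.sum_comm (s := (Finset.univ : Finset (Σ i, V i)))
    (t := (Finset.univ : Finset ι))]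
  refine Finset.sum_congr rfl fun p _ => Finset.sum_congr rfl fun q _ => ?_
  simp_rw [← Finset.mul_sum]
  by_cases hpq : T.Adj p q
  · rw [← Finset.sum_mul, sum_realDegree_mul_sideInd_eq_chainWbar hT hG hpq,
      sum_realDegree_mul_sideInd_eq_chainWbar hT hG hpq.symm]
  · rw [indicatorOf_neg hpq, zero_mul, zero_mul]

theorem kemeny_chain (hT : T.IsTree) (hG : ∀ i, (G i).Connected) :
    (T.chain G b).kemeny = ∑ i, (G i).kemeny
      + ∑ i, ∑ j, indicatorOf (T.Adj i j) *
          (T.chainWbar G b i j / ((T.chain G b).numEdges : ℝ) * (G i).accessibility (b i j))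
      + ∑ i, ∑ j, indicatorOf (T.Adj i j) * ∑ j', indicatorOf (T.Adj i j') *
          (T.chainWbar G b i j * T.chainWbar G b i j'
              / (2 * ((T.chain G b).numEdges : ℝ) * ((G i).numEdges : ℝ))
            * ((G i).meanFirstPassage (b i j) (b i j')
              + (G i).meanFirstPassage (b i j') (b i j)))
      + ∑ i, ∑ j, indicatorOf (T.Adj i j) *
          ((2 * T.chainWbar G b i j - 1) * (2 * T.chainWbar G b j i - 1)
            / (4 * ((T.chain G b).numEdges : ℝ))) := by
  choose R hR using fun i => exists_isResistance (hG i)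
  have hsum : ∑ x, ∑ y, (T.chain G b).realDegree x * (T.chain G b).realDegree y *
      T.chainResistance b R x y =
      ∑ l, ∑ x, ∑ y, (T.chain G b).realDegree x * (T.chain G b).realDegree y *
        R l (T.chainProj b l x) (T.chainProj b l y) +
      ∑ x, ∑ y, (T.chain G b).realDegree x * (T.chain G b).realDegree y *
        T.separation x.1 y.1 := by
    simp_rw [chainResistance, mul_add, Finset.mul_sum, Finset.sum_add_distrib]
    simp_rw [Finset.sum_comm (s := (Finset.univ : Finset (Σ i, V i)))
      (t := (Finset.univ : Finset ι))]
  rw [(isResistance_chainResistance hT hR).kemeny_eq (chain_connected hT.connected hG), hsum,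
    sum_sum_realDegree_mul_separation hT hG, add_div, Finset.sum_div, Finset.sum_div,
    ← Finset.sum_add_distrib, ← Finset.sum_add_distrib, ← Finset.sum_add_distrib,
    ← Finset.sum_add_distrib]
  refine Finset.sum_congr rfl fun l _ => ?_
  congr 1
  · rw [sum_sum_realDegree_mul_resistance_chainProj hT hG (hR l),
      mul_div_mul_left _ _ (by norm_num), add_div, add_div, Finset.sum_div, Finset.sum_div]
    congr 1
    · congr 1
      -- If the chain has no edges, neither has `G l`, and its Kemeny constant is `0`.
      · by_cases hm : ((T.chain G b).numEdges : ℝ) = 0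
        · rw [hm, div_zero, (hR l).kemeny_eq (hG l), numEdges_eq_zero_of_chain hT hG hm l,
            mul_zero, div_zero]
        · rw [mul_div_cancel_left₀ _ hm]
      · exact Finset.sum_congr rfl fun j _ => by ring
    · refine Finset.sum_congr rfl fun j _ => ?_
      rw [mul_div_assoc, Finset.sum_div]
      congr 1
      refine Finset.sum_congr rfl fun j' _ => ?_
      rw [mul_div_assoc]
      congr 1
      rw [(hR l).meanFirstPassage_add (hG l)]
      -- For a single-vertex constituent the resistance is `0`, in agreement with the convention for
      -- the third sum.
      by_cases hm : ((G l).numEdges : ℝ) = 0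
      · rw [(hR l).eq_zero_of_numEdges (hG l) hm]
        simp
      · by_cases hm' : ((T.chain G b).numEdges : ℝ) = 0
        · simp [hm']
        · field_simp
  · rw [Finset.sum_div]
    exact Finset.sum_congr rfl fun q _ => by ring

end ChainKemeny

/-- A sum over ordered pairs of adjacent vertices, as a sum over edges. -/
theorem sum_edges_eq_sum_indicatorOf {k : ℕ} (T : SimpleGraph (Fin k)) [DecidableRel T.Adj]
    (F : Fin k → Fin k → ℝ) :
    ∑ e : Fin k × Fin k with e.1 < e.2 ∧ T.Adj e.1 e.2, (F e.1 e.2 + F e.2 e.1) =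
      ∑ i, ∑ j, indicatorOf (T.Adj i j) * F i j := by
  have h : ∑ i, ∑ j, indicatorOf (T.Adj i j) * F i j =
      ∑ i, ∑ j, indicatorOf (i < j ∧ T.Adj i j) * F i j +
        ∑ i, ∑ j, indicatorOf (j < i ∧ T.Adj j i) * F i j := by
    rw [← Finset.sum_add_distrib]
    refine Finset.sum_congr rfl fun i _ => ?_
    rw [← Finset.sum_add_distrib]
    refine Finset.sum_congr rfl fun j _ => ?_
    by_cases hij : T.Adj i j
    · rcases lt_or_gt_of_ne hij.ne with h | h
      · simp [indicatorOf, hij, h, h.le]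
      · simp [indicatorOf, hij, hij.symm, h, h.le]
    · simp [indicatorOf, hij, T.adj_comm j i]
  rw [sum_filter_eq_sum_indicatorOf (fun e : Fin k × Fin k => e.1 < e.2 ∧ T.Adj e.1 e.2),
    Fintype.sum_prod_type, h,
    Finset.sum_comm (f := fun i j => indicatorOf (j < i ∧ T.Adj j i) * F i j),
    ← Finset.sum_add_distrib]
  refine Finset.sum_congr rfl fun i _ => ?_
  rw [← Finset.sum_add_distrib]
  exact Finset.sum_congr rfl fun j _ => by ring

end

end SimpleGraph

/-- The bridges are indexed by the edges `i ∼ j` of `T`, and their ends in `G i` by the neighbours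
`j` of `i`, so a vertex that carries several bridges is counted once for each of them. -/
theorem theorem3p9 {k : ℕ} (T : SimpleGraph (Fin k)) [DecidableRel T.Adj] (hT : T.IsTree)
    {V : Fin k → Type*} [∀ i, Fintype (V i)]
    (G : (i : Fin k) → SimpleGraph (V i)) (hG : ∀ i, (G i).Connected)
    (b : (i j : Fin k) → V i) :
    (T.chain G b).kemeny =
      (∑ i, (G i).kemeny)
      + (∑ e : Fin k × Fin k with e.1 < e.2 ∧ T.Adj e.1 e.2,
          (T.chainWbar G b e.1 e.2 / ((T.chain G b).numEdges : ℝ)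
              * (G e.1).accessibility (b e.1 e.2)
            + T.chainWbar G b e.2 e.1 / ((T.chain G b).numEdges : ℝ)
              * (G e.2).accessibility (b e.2 e.1)))
      + (∑ i, ∑ j₁ with T.Adj i j₁, ∑ j₂ with T.Adj i j₂,
          T.chainWbar G b i j₁ * T.chainWbar G b i j₂
              / (2 * ((T.chain G b).numEdges : ℝ) * ((G i).numEdges : ℝ))
            * ((G i).meanFirstPassage (b i j₁) (b i j₂)
              + (G i).meanFirstPassage (b i j₂) (b i j₁)))
      + (∑ e : Fin k × Fin k with e.1 < e.2 ∧ T.Adj e.1 e.2,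
          (2 * T.chainWbar G b e.1 e.2 - 1) * (2 * T.chainWbar G b e.2 e.1 - 1)
            / (2 * ((T.chain G b).numEdges : ℝ))) := by
  have h2 := SimpleGraph.sum_edges_eq_sum_indicatorOf T fun i j =>
    T.chainWbar G b i j / ((T.chain G b).numEdges : ℝ) * (G i).accessibility (b i j)
  -- This summand is symmetric, so the two orientations of an edge turn the denominator `4 m` into
  -- `2 m`.
  have h4 := SimpleGraph.sum_edges_eq_sum_indicatorOf T fun i j =>
    (2 * T.chainWbar G b i j - 1) * (2 * T.chainWbar G b j i - 1)
      / (4 * ((T.chain G b).numEdges : ℝ))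
  rw [SimpleGraph.kemeny_chain hT hG, ← h2, ← h4]
  simp_rw [SimpleGraph.sum_filter_eq_sum_indicatorOf (fun j => T.Adj _ j)]
  congr 1
  exact Finset.sum_congr rfl fun e _ => by ring
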